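/- Cards are placed on a table; a protocol may publicly rearrange cards, turn cards over, and apply shuffles, each instruction depending only on the visible sequence trace (the list of all sequences of visible symbols so far). A uniform closed shuffle over a permutation group $\Pi$ applies a uniformly random, unseen $\pi\in\Pi$ to the cards; a pile-scramble shuffle (PSS) permutes $k$ piles of $s$ cards each by a uniformly random element of $\mathfrak S_k$, keeping the order inside the piles. Let $H$ be a finite hypergraph with vertex set $\{1,\dots,n\}$ and family of hyperedges $e_1,\dots,e_m\subseteq\{1,\dots,n\}$. For hypergraphs $H,H'$ with $n$ vertices and $m$ hyperedges, $\mathsf{Iso}(H,H')$ is the set of $f\in\mathfrak S_n$ for which there is $\sigma\in\mathfrak S_m$ with $f(e_j)=e'_{\sigma(j)}$ for all $j$, and $\mathsf{Aut}(H)=\mathsf{Iso}(H,H)$. Put $E^{(i)}=\{j\mid i\in e_j\}$, $d'=|\{|E^{(i)}| : 1\le i\le n\}|$ and $\ell=|\{|e_j| : 1\le j\le m\}|$. The hypergraph shuffle protocol for an input sequence $x=(x_1,\dots,x_n)$ of face-down cards uses as helping cards $|e_j|$ face-up copies of the symbol $j$ for each $j$, and proceeds as follows. (1) Turn the helping cards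 face down; the copies of $j$ form the $j$-th edge pile. (2) For each size $s$ occurring among the hyperedges, apply a PSS to the edge piles of size $s$; let $\alpha_j$ be the symbol on the cards of the pile now in place $j$. (3) Let the $i$-th vertex pile consist of $x_i$ followed by one card $\alpha_j$, out of the pile in place $j$, for each $j\in E^{(i)}$ in increasing order. (4) For each $i$, apply a PSS to the single cards of the $i$-th vertex pile other than the first one. (5) For each degree $d$ occurring among the vertices, apply a PSS to the vertex piles with $d+1$ cards. (6) Open all cards except the first card $y_k$ of each pile $k$. (7) Let $H'$ be the hypergraph with vertices $1,\dots,n$ and hyperedges $\widetilde e_1,\dots,\widetilde e_m$, where $k\in\widetilde e_j$ if and only if the symbol $j$ appears in the pile $k$. (8) Choose any $\psi\in\mathsf{Iso}(H,H')$, depending only on the visible sequence trace, and output $z=(y_{\psi(1)},\dots,y_{\psi(n)})$, face down; sort the helping cards into their original order. Then, for every $H$, every input $x$ and every rule for the choices in step (8): (a) The set $\mathsf{Iso}(H,H')$ in step (8) is never empty, and the helping cards can be sorted; so the protocol can always be completed. (b) The protocol implements the uniform closed shuffle over $\mathsf{Aut}(H)$: every run ends with $z=g(x)$, i.e. $z_k=x_{g^{-1}(k)}$,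 for some $g\in\mathsf{Aut}(H)$, followed by the helping cards in their original state; $g$ is uniformly distributed on $\mathsf{Aut}(H)$; and $g$ is independent of the visible sequence trace (in particular, of the opened symbols). (c) All shuffles of the protocol are pile-scramble shuffles, and their number is $n+d'+\ell$ (a PSS of no or one pile, or of empty piles, is counted). (d) The number of cards is $n+\sum_{j=1}^m|e_j|$. (e) In particular, if all hyperedges have exactly two elements, so that $H$ is an undirected graph with $n$ vertices and $m$ edges, then the protocol uses $n+2m$ cards and implements the graph shuffle of the undirected graph, i.e. the uniform closed shuffle over the group of those vertex permutations that are induced by automorphisms of the directed graph obtained by replacing each edge by two opposite directed edges. -/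

import Mathlib

open Equiv

/-! ## A model of card-based protocols

`κ` is the (finite) set of places on the table. Every place holds exactly one card, and a card is
named by the place at which it lies at the beginning. `S` is the set of symbols on the cards. -/

namespace CardBased

universe u v

variable {κ : Type u} {S : Type v}

/-- The actions of a protocol: turning over the cards at the places in `T`, rearranging the cards
publicly (the card at place `p` moves to place `π p`), and the uniform closed shuffle over `G`. -/
inductive Action (κ : Type u) : Type u
  | turn (T : Finset κ) : Action κ
  | perm (π : Perm κ) : Action κ
  | shuffle (G : Subgroup (Perm κ)) : Action κ

def Action.IsShuffle : Action κ → Prop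
  | .shuffle _ => True
  | _ => False

/-- What is seen of a sequence of cards: the symbols of the cards that lie face up. -/
abbrev Visible (κ : Type u) (S : Type v) := κ → Option S

structure Config (κ : Type u) (S : Type v) where
  /-- `card p` is the card at place `p`. -/
  card : Perm κ
  /-- the places whose card lies face up -/
  up : Finset κ
  /-- the visible sequence trace: all visible sequences so far, the latest one first -/
  trace : List (Visible κ S)
  /-- the actions performed so far, the latest one first -/
  log : List (Action κ)

open Classical in
/-- The visible sequence, if the card `c` carries the symbol `sym c`. -/
noncomputable def visible (sym : κ → S) (card : Perm κ) (up : Finset κ) : Visible κ S :=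
  fun p => if p ∈ up then some (sym (card p)) else none

/-- The configuration in which card `p` lies at place `p`, face up exactly for `p ∈ up`. -/
noncomputable def Config.initial (sym : κ → S) (up : Finset κ) : Config κ S :=
  ⟨1, up, [visible sym 1 up], []⟩

/-- The configuration after the action `a`, if it leads to the cards `card` and faces `up`. -/
noncomputable def Config.next (sym : κ → S) (c : Config κ S) (a : Action κ)
    (card : Perm κ) (up : Finset κ) : Config κ S :=
  ⟨card, up, visible sym card up :: c.trace, a :: c.log⟩

/-- The cards are permuted by `π` in the course of the action `a`: the card at `p`, with its face,
moves to `π p`. -/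
noncomputable def Config.move (sym : κ → S) (c : Config κ S) (a : Action κ) (π : Perm κ) :
    Config κ S :=
  c.next sym a (c.card * π⁻¹) (c.up.map π.toEmbedding)

open Classical in
/-- The law of the configuration after one action. -/
noncomputable def act [Fintype κ] (sym : κ → S) (c : Config κ S) : Action κ → PMF (Config κ S)
  | .turn T => PMF.pure (c.next sym (.turn T) c.card (symmDiff c.up T))
  | .perm π => PMF.pure (c.move sym (.perm π) π)
  | .shuffle G => (PMF.uniformOfFintype G).map fun g => c.move sym (.shuffle G) (g : Perm κ)

/-- A protocol is a finite list of instructions, each of which determines an action from the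
visible sequence trace so far. -/
abbrev Protocol (κ : Type u) (S : Type v) := List (List (Visible κ S) → Action κ)

/-- The law of the final configuration of a protocol started from `c`. -/
noncomputable def run [Fintype κ] (sym : κ → S) : Protocol κ S → Config κ S → PMF (Config κ S)
  | [], c => PMF.pure c
  | a :: P, c => (act sym c (a c.trace)).bind (run sym P)

/-- The group of a pile-scramble shuffle: `pile (a, r)` is the place of the `r`-th card of the
pile `a`. The piles are permuted, the order inside the piles and all other cards are kept. -/
def pileScramble {ι σ : Type*} (pile : ι × σ ↪ κ) : Subgroup (Perm κ) where
  carrier := {g | ∃ π : Perm ι, (∀ a r, g (pile (a, r)) = pile (π a, r)) ∧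
    ∀ p, p ∉ Set.range pile → g p = p}
  one_mem' := ⟨1, fun _ _ => rfl, fun _ _ => rfl⟩
  mul_mem' := by
    rintro g h ⟨π, hπ, hg⟩ ⟨ρ, hρ, hh⟩
    refine ⟨π * ρ, fun a r => ?_, fun p hp => ?_⟩
    · rw [Perm.mul_apply, hρ, hπ, Perm.mul_apply]
    · rw [Perm.mul_apply, hh p hp, hg p hp]
  inv_mem' := by
    rintro g ⟨π, hπ, hg⟩
    refine ⟨π⁻¹, fun a r => ?_, fun p hp => ?_⟩
    · rw [Perm.inv_eq_iff_eq, hπ]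
      exact congrArg (fun b => pile (b, r)) (π.apply_symm_apply a).symm
    · rw [Perm.inv_eq_iff_eq, hg p hp]

/-- `a` is the shuffle `PSS_(k, s)` of some `k` piles of `s` cards each. -/
def Action.IsPileScramble (a : Action κ) : Prop :=
  ∃ (k s : ℕ) (pile : Fin k × Fin s ↪ κ), a = .shuffle (pileScramble pile)

/-- Stochastic independence of `f` and `g` under a discrete law (every set is an event). -/
def Independent {Ω α β : Type*} (p : PMF Ω) (f : Ω → α) (g : Ω → β) : Prop :=
  @ProbabilityTheory.IndepFun Ω α β ⊤ ⊤ ⊤ f g (@PMF.toMeasure Ω ⊤ p)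

/-! ### Implementing a shuffle

The places are `V ⊕ W`: at the beginning the input cards lie face down at `V`, and helping cards
lie face up at `W`. -/

variable {V W : Type u}

/-- The input cards are permuted by `g` in total: input card `i` ends at place `g i`, that is, the
output sequence `z` for the input `x` is `g(x)`, `z k = x (g⁻¹ k)`. -/
def Config.Permutes (c : Config (V ⊕ W) S) (g : Perm V) : Prop :=
  ∀ i, c.card (.inl (g i)) = .inl i

open Classical in
/-- The permutation of the input cards (`1` if they are not all at the places `V`). -/
noncomputable def Config.outPerm (c : Config (V ⊕ W) S) : Perm V :=
  if h : ∃ g, c.Permutes g then h.choose else 1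

/-- The places of the helping cards. -/
def helpPlaces (V W : Type u) [Fintype W] : Finset (V ⊕ W) :=
  Finset.univ.map Function.Embedding.inr

/-- The law of the final configuration for the input symbols `x` and helping symbols `h`. -/
noncomputable def exec [Fintype V] [Fintype W] (P : Protocol (V ⊕ W) S) (h : W → S) (x : V → S) :
    PMF (Config (V ⊕ W) S) :=
  run (Sum.elim x h) P (.initial (Sum.elim x h) (helpPlaces V W))

open Classical in
/-- `P`, with helping symbols `h`, implements the uniform closed shuffle over `G`. -/
structure Implements [Fintype V] [Fintype W] (P : Protocol (V ⊕ W) S) (h : W → S)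
    (G : Subgroup (Perm V)) : Prop where
  /-- For every input `x`, each run ends with `g(x)` for some `g ∈ G`, face down, followed by
  the helping cards, face up and in their original order. -/
  final : ∀ (x : V → S), ∀ c ∈ (exec P h x).support,
    c.Permutes c.outPerm ∧ c.outPerm ∈ G ∧ c.up = helpPlaces V W ∧
      ∀ w, Sum.elim x h (c.card (.inr w)) = h w
  /-- The permutation is uniformly distributed on `G`. -/
  correct : ∀ x : V → S,
    (exec P h x).map Config.outPerm = (PMF.uniformOfFintype G).map Subtype.val
  /-- The permutation is independent of the visible sequence trace. -/
  secure : ∀ x : V → S, Independent (exec P h x) Config.outPerm Config.trace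

end CardBased

/-! ## Hypergraphs -/

/-- A hypergraph with vertices `0, …, n - 1` and a family of hyperedges `edge 0, …, edge (m - 1)`
(any sets of vertices; repetitions are allowed). -/
@[ext] structure FinHypergraph (n m : ℕ) where
  edge : Fin m → Finset (Fin n)

namespace FinHypergraph

variable {n m : ℕ}

/-- The isomorphisms from `H` to `H'`. -/
def Iso (H H' : FinHypergraph n m) : Set (Perm (Fin n)) :=
  {f | ∃ σ : Perm (Fin m), ∀ j, (H.edge j).map f.toEmbedding = H'.edge (σ j)}

/-- The automorphism group of `H`. -/
def aut (H : FinHypergraph n m) : Subgroup (Perm (Fin n)) where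
  carrier := H.Iso H
  one_mem' := ⟨1, fun j => Finset.map_refl⟩
  mul_mem' := by
    rintro f g ⟨σ, hσ⟩ ⟨τ, hτ⟩
    refine ⟨σ * τ, fun j => ?_⟩
    rw [Perm.mul_apply, ← hσ, ← hτ, Finset.map_map]
    rfl
  inv_mem' := by
    rintro f ⟨σ, hσ⟩
    refine ⟨σ⁻¹, fun j => ?_⟩
    have h : _ = H.edge j := (hσ (σ⁻¹ j)).trans (congrArg H.edge (σ.apply_symm_apply j))
    rw [← h, Finset.map_map]
    ext; simp

/-- The set `E^(i)` of the indices of the hyperedges that contain the vertex `i`. -/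
def incident (H : FinHypergraph n m) (i : Fin n) : Finset (Fin m) :=
  Finset.univ.filter fun j => i ∈ H.edge j

/-- The sizes of the hyperedges. -/
def sizes (H : FinHypergraph n m) : Finset ℕ := Finset.univ.image fun j => (H.edge j).card

/-- The degrees of the vertices. -/
def degrees (H : FinHypergraph n m) : Finset ℕ := Finset.univ.image fun i => (H.incident i).card

/-! ### The hypergraph shuffle protocol -/

/-- The places of the helping cards: one place for each pair of a vertex `i` and a hyperedge `j`
that contains it. At first, the places `(·, j)` are those of `pile[j]`, ordered by the vertices.
Afterwards, the places `(i, ·)`, ordered by the hyperedges, are those of the helping cards in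
`vertex[i]`, so that `vertex[i]` gets one card out of the `j`-th pile for each `j ∈ E^(i)`. -/
abbrev Slot (H : FinHypergraph n m) : Type := {p : Fin n × Fin m // p.1 ∈ H.edge p.2}

/-- All places; `Sum.inl i` is the place of the `i`-th input card, later the first card of the
`i`-th vertex pile. -/
abbrev Place (H : FinHypergraph n m) : Type := Fin n ⊕ H.Slot

/-- The piles of those hyperedges that have `s` elements. -/
def edgePile (H : FinHypergraph n m) (s : ℕ) :
    {j : Fin m // (H.edge j).card = s} × Fin s ↪ H.Place where
  toFun p := .inr ⟨((H.edge p.1).orderEmbOfFin p.1.2 p.2, p.1), Finset.orderEmbOfFin_mem _ _ _⟩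
  inj' := by
    rintro ⟨⟨j, hj⟩, r⟩ ⟨⟨j', hj'⟩, r'⟩ h
    simp only [Sum.inr.injEq, Subtype.mk.injEq, Prod.mk.injEq] at h
    obtain ⟨h, rfl⟩ := h
    simpa using h

/-- The helping cards of the `i`-th vertex pile, as piles of one card each. -/
def vertexCards (H : FinHypergraph n m) (i : Fin n) :
    {j : Fin m // i ∈ H.edge j} × Fin 1 ↪ H.Place where
  toFun p := .inr ⟨(i, p.1), p.1.2⟩
  inj' := by
    rintro ⟨⟨j, hj⟩, r⟩ ⟨⟨j', hj'⟩, r'⟩ h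
    simp only [Sum.inr.injEq, Subtype.mk.injEq, Prod.mk.injEq, true_and] at h
    subst h
    rw [Subsingleton.elim r r']

/-- The vertex piles of those vertices that have degree `d`; they have `d + 1` cards, of which
`none` is the first one. -/
def vertexPile (H : FinHypergraph n m) (d : ℕ) :
    {i : Fin n // (H.incident i).card = d} × Option (Fin d) ↪ H.Place where
  toFun p := match p.2 with
    | none => .inl p.1
    | some r => .inr ⟨(p.1, (H.incident p.1).orderEmbOfFin p.1.2 r),
        (Finset.mem_filter.mp (Finset.orderEmbOfFin_mem _ p.1.2 r)).2⟩
  inj' := by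
    rintro ⟨⟨i, hi⟩, r⟩ ⟨⟨i', hi'⟩, r'⟩ h
    rcases r with _ | r <;> rcases r' with _ | r'
    · simpa using h
    · simp at h
    · simp at h
    · simp only [Sum.inr.injEq, Subtype.mk.injEq, Prod.mk.injEq] at h
      obtain ⟨rfl, h⟩ := h
      simpa using h

open CardBased

variable {S : Type*}

open Classical in
/-- The hypergraph `H'` read off from the opened symbols `v`: the vertex `k` belongs to the `j`-th
hyperedge if and only if the symbol `num j` appears in the `k`-th vertex pile. -/
noncomputable def opened (H : FinHypergraph n m) (num : Fin m ↪ S) (v : Visible H.Place S) :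
    FinHypergraph n m where
  edge j := Finset.univ.filter fun k => ∃ (j' : Fin m) (h : k ∈ H.edge j'),
    v (.inr ⟨(k, j'), h⟩) = some (num j)

/-- `π` is an admissible final rearrangement if the symbols `v` have been opened: for an
isomorphism `ψ : H → H'`, the first card of the pile `ψ i` is moved to place `i` of the output, and
the helping cards are sorted into their original order. -/
def IsFinalMove (H : FinHypergraph n m) (num : Fin m ↪ S) (v : Visible H.Place S)
    (π : Perm H.Place) : Prop :=
  ∃ ψ ∈ H.Iso (H.opened num v), (∀ i, π (.inl (ψ i)) = .inl i) ∧
    ∀ w : H.Slot, v (π⁻¹ (.inr w)) = some (num w.1.2)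

/-- `rule` is a way of carrying out the last step: given the visible sequence trace (with latest
visible sequence `v`), it selects an admissible final rearrangement whenever there is one. -/
def IsFinalRule (H : FinHypergraph n m) (num : Fin m ↪ S)
    (rule : List (Visible H.Place S) → Perm H.Place) : Prop :=
  ∀ v t, (∃ π, H.IsFinalMove num v π) → H.IsFinalMove num v (rule (v :: t))

/-- The protocol up to the opening of the symbols: turn the helping cards face down; apply a
generalized pile-scramble protocol to the piles of the hyperedges; form the vertex piles; in each
of them shuffle the helping cards; apply a generalized pile-scramble protocol to the vertex piles;
open the helping cards. -/
noncomputable def protocolOpen (H : FinHypergraph n m) (S : Type*) : Protocol H.Place S :=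
  [fun _ => .turn (helpPlaces _ _)]
    ++ H.sizes.toList.map (fun s _ => .shuffle (pileScramble (H.edgePile s)))
    ++ (List.finRange n).map (fun i _ => .shuffle (pileScramble (H.vertexCards i)))
    ++ H.degrees.toList.map (fun d _ => .shuffle (pileScramble (H.vertexPile d)))
    ++ [fun _ => .turn (helpPlaces _ _)]

/-- The hypergraph shuffle protocol. -/
noncomputable def protocol (H : FinHypergraph n m)
    (rule : List (Visible H.Place S) → Perm H.Place) : Protocol H.Place S :=
  H.protocolOpen S ++ [fun t => .perm (rule t)]

/-- The symbols of the helping cards: `|e_j|` copies of `num j` for each `j`. -/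
def helpSymbol (H : FinHypergraph n m) (num : Fin m ↪ S) (w : H.Slot) : S := num w.1.2

end FinHypergraph

/-! ## Directed graphs -/

/-- A directed graph (parallel edges and loops are allowed). -/
structure DirGraph (V E : Type*) where
  source : E → V
  target : E → V

/-- The permutations of the vertices that belong to an automorphism of `G`. -/
def DirGraph.aut₀ {V E : Type*} (G : DirGraph V E) : Subgroup (Perm V) where
  carrier := {f | ∃ f₁ : Perm E, ∀ a,
    G.source (f₁ a) = f (G.source a) ∧ G.target (f₁ a) = f (G.target a)}
  one_mem' := ⟨1, fun _ => ⟨rfl, rfl⟩⟩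
  mul_mem' := by
    rintro f g ⟨f₁, hf⟩ ⟨g₁, hg⟩
    refine ⟨f₁ * g₁, fun a => ⟨?_, ?_⟩⟩
    · rw [Perm.mul_apply, (hf _).1, (hg _).1, Perm.mul_apply]
    · rw [Perm.mul_apply, (hf _).2, (hg _).2, Perm.mul_apply]
  inv_mem' := by
    rintro f ⟨f₁, hf⟩
    refine ⟨f₁⁻¹, fun a => ⟨?_, ?_⟩⟩
    · have h : G.source a = _ := (congrArg G.source (f₁.apply_symm_apply a)).symm.trans (hf (f₁⁻¹ a)).1
      rw [h]
      exact (f.symm_apply_apply _).symm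
    · have h : G.target a = _ := (congrArg G.target (f₁.apply_symm_apply a)).symm.trans (hf (f₁⁻¹ a)).2
      rw [h]
      exact (f.symm_apply_apply _).symm

/-- The directed graph of an undirected graph (a hypergraph all of whose hyperedges have two
elements): each edge `j = {u, v}` is replaced by the two directed edges `u → v` and `v → u`. -/
def FinHypergraph.toDirGraph {n m : ℕ} (H : FinHypergraph n m) :
    DirGraph (Fin n) {a : (Fin n × Fin n) × Fin m // a.1.1 ≠ a.1.2 ∧ H.edge a.2 = {a.1.1, a.1.2}} where
  source a := a.1.1.1
  target a := a.1.1.2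

/-! Each of the three rounds of shuffles acts on disjoint families of piles, so its total effect is
a uniform element of a group: `a` in `edgeGroup`, `b` in `cardGroup`, `d` in `vertexGroup`, and the
cards are permuted by `d * b * a`. All cards lie face down meanwhile, so nothing else is seen
(`run_shuffles`, `shuffleLaw_shuffles`).

Completion: if `a` moves pile `j` to place `ρ j` and `d` moves vertex pile `i` to place `τ i`, the
symbol `j` is opened exactly in the piles `τ i` with `i` in the hyperedge `ρ j`. Hence `τ` is an
isomorphism from `H` to the opened hypergraph (`exists_isRegular`), and the chosen `ψ` yields the
output permutation `ψ⁻¹ * τ`, an automorphism (`finalConfig_spec`).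

Uniformity and secrecy both follow from one symmetry: for every automorphism `f`, the joint law of
the output permutation and the trace is unchanged when the output is multiplied by `f` on the right
(`law_invariant`). To see this, `a`, `b`, `d` are replaced by measure-preserving modifications
(`exists_translation`) whose product is `d * b * a * ε`, where `ε` acts as `f` on the input cards
and only exchanges helping cards with equal symbols. The opened symbols, hence `ψ`, stay the same,
while `τ` becomes `τ * f`. A law with this invariance is uniform on the group and independent of the
trace (`map_eq_uniformOn_of_invariant`, `independent_of_invariant`). -/

namespace CardBased

universe u v

theorem _root_.PMF.bind_congr_support {α β : Type*} (p : PMF α) {f g : α → PMF β}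
    (h : ∀ a ∈ p.support, f a = g a) : p.bind f = p.bind g := by
  ext b
  rw [PMF.bind_apply, PMF.bind_apply]
  refine tsum_congr fun a => ?_
  by_cases ha : p a = 0
  · simp [ha]
  · rw [h a ha]

theorem _root_.PMF.map_congr_support {α β : Type*} (p : PMF α) {f g : α → β}
    (h : ∀ a ∈ p.support, f a = g a) : p.map f = p.map g :=
  p.bind_congr_support fun a ha => congrArg PMF.pure (h a ha)

/-! ### Uniform elements of subgroups, and invariance as a criterion for independence. -/

section UniformOn

variable {Γ : Type*} [Group Γ] [Finite Γ]

/-- The uniform distribution on a subgroup, as a law on the whole group. -/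
noncomputable def uniformOn (G : Subgroup Γ) : PMF Γ :=
  letI := Fintype.ofFinite G
  (PMF.uniformOfFintype G).map Subtype.val

theorem map_uniformOfFintype {β : Type*} (G : Subgroup Γ) {_ : Fintype G} (f : Γ → β) :
    ((PMF.uniformOfFintype G).map fun g : G => f g) = (uniformOn G).map f := by
  rw [uniformOn, PMF.map_comp]
  congr!

theorem mem_support_uniformOn {G : Subgroup Γ} {g : Γ} : g ∈ (uniformOn G).support ↔ g ∈ G := by
  simp [uniformOn]

open Classical in
theorem uniformOn_apply (G : Subgroup Γ) (g : Γ) :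
    uniformOn G g = if g ∈ G then (Nat.card G : ENNReal)⁻¹ else 0 := by
  rw [uniformOn, PMF.map_apply]
  split_ifs with h
  · rw [tsum_eq_single ⟨g, h⟩]
    · simp [Fintype.card_eq_nat_card]
    · rintro ⟨b, hb⟩ hne
      rw [if_neg]
      rintro rfl
      exact hne rfl
  · rw [ENNReal.tsum_eq_zero]
    rintro ⟨b, hb⟩
    rw [if_neg]
    rintro rfl
    exact h hb

theorem _root_.PMF.map_equiv_apply {α β : Type*} (p : PMF α) (e : α ≃ β) (b : β) :
    p.map e b = p (e.symm b) := by
  classical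
  rw [PMF.map_apply, tsum_eq_single (e.symm b)]
  · simp
  · intro a ha
    rw [if_neg]
    rintro rfl
    simp at ha

/-- The bijection `e` need not be a homomorphism, so this covers translations as well as
conjugations followed by a translation. -/
theorem uniformOn_map_equiv (G : Subgroup Γ) (e : Γ ≃ Γ) (he : ∀ g, e g ∈ G ↔ g ∈ G) :
    (uniformOn G).map e = uniformOn G := by
  ext g
  rw [PMF.map_equiv_apply, uniformOn_apply, uniformOn_apply]
  congr 1
  rw [← he, e.apply_symm_apply]

theorem uniformOn_map_mul_right {G : Subgroup Γ} {h : Γ} (hh : h ∈ G) :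
    (uniformOn G).map (· * h) = uniformOn G :=
  uniformOn_map_equiv G (Equiv.mulRight h) fun _ => G.mul_mem_cancel_right hh

theorem uniformOn_map_mul_left {G : Subgroup Γ} {h : Γ} (hh : h ∈ G) :
    (uniformOn G).map (h * ·) = uniformOn G :=
  uniformOn_map_equiv G (Equiv.mulLeft h) fun _ => G.mul_mem_cancel_left hh

/-- If the law of `(f, t)` does not change when `f` is multiplied by elements of `G`, and `f` has
its values in `G`, then `f` is uniformly distributed on `G`, independently of `t`. -/
theorem map_prod_eq_of_invariant {Ω Y : Type*} (p : PMF Ω) (f : Ω → Γ) (t : Ω → Y)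
    (G : Subgroup Γ) (hf : ∀ ω ∈ p.support, f ω ∈ G)
    (hinv : ∀ h ∈ G, p.map (fun ω => (f ω * h, t ω)) = p.map fun ω => (f ω, t ω)) :
    p.map (fun ω => (f ω, t ω)) = p.bind fun ω => (uniformOn G).map fun g => (g, t ω) := by
  -- The invariance is averaged over a uniform `h`. After exchanging the two draws, the factor `f ω
  -- ∈ G` is absorbed by the left invariance of the uniform law.
  calc p.map (fun ω => (f ω, t ω))
      = (uniformOn G).bind fun _ => p.map (fun ω => (f ω, t ω)) := (PMF.bind_const _ _).symm
    _ = (uniformOn G).bind fun h => p.map (fun ω => (f ω * h, t ω)) :=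
      PMF.bind_congr_support _ fun h hh => (hinv h (mem_support_uniformOn.1 hh)).symm
    _ = p.bind fun ω => (uniformOn G).map fun h => (f ω * h, t ω) := PMF.bind_comm _ _ _
    _ = _ := PMF.bind_congr_support _ fun ω hω => by
      conv_rhs => rw [← uniformOn_map_mul_left (hf ω hω), PMF.map_comp]
      rfl

theorem map_eq_uniformOn_of_invariant {Ω Y : Type*} (p : PMF Ω) (f : Ω → Γ) (t : Ω → Y)
    (G : Subgroup Γ) (hf : ∀ ω ∈ p.support, f ω ∈ G)
    (hinv : ∀ h ∈ G, p.map (fun ω => (f ω * h, t ω)) = p.map fun ω => (f ω, t ω)) :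
    p.map f = uniformOn G := by
  have := congrArg (PMF.map Prod.fst) (map_prod_eq_of_invariant p f t G hf hinv)
  rw [PMF.map_comp, PMF.map_bind] at this
  simp only [PMF.map_comp] at this
  refine Eq.trans this ?_
  conv_rhs => rw [← PMF.bind_const p (uniformOn G)]
  congr 1
  funext ω
  exact PMF.map_id _

theorem independent_of_invariant {Ω Y : Type*} (p : PMF Ω) (f : Ω → Γ) (t : Ω → Y)
    (G : Subgroup Γ) (hf : ∀ ω ∈ p.support, f ω ∈ G)
    (hinv : ∀ h ∈ G, p.map (fun ω => (f ω * h, t ω)) = p.map fun ω => (f ω, t ω)) :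
    Independent p f t := by
  classical
  have h1 := map_prod_eq_of_invariant p f t G hf hinv
  have h2 := map_eq_uniformOn_of_invariant p f t G hf hinv
  unfold Independent
  let _ : MeasurableSpace Ω := ⊤
  let _ : MeasurableSpace Γ := ⊤
  let _ : MeasurableSpace Y := ⊤
  rw [ProbabilityTheory.IndepFun_iff]
  rintro _ _ ⟨A, -, rfl⟩ ⟨B, -, rfl⟩
  simp only [PMF.toMeasure_apply_eq_toOuterMeasure]
  have h3 : p.toOuterMeasure (f ⁻¹' A ∩ t ⁻¹' B) =
      (p.map fun ω => (f ω, t ω)).toOuterMeasure (A ×ˢ B) := by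
    rw [PMF.toOuterMeasure_map_apply]
    rfl
  have h4 : p.toOuterMeasure (f ⁻¹' A) = (uniformOn G).toOuterMeasure A := by
    rw [← h2, PMF.toOuterMeasure_map_apply]
  rw [h3, h4, h1, PMF.toOuterMeasure_bind_apply, PMF.toOuterMeasure_apply p, ← ENNReal.tsum_mul_left]
  refine tsum_congr fun ω => ?_
  rw [PMF.toOuterMeasure_map_apply]
  by_cases hω : t ω ∈ B
  · have : (fun g => (g, t ω)) ⁻¹' (A ×ˢ B) = A := by ext; simp [hω]
    rw [this, Set.indicator_of_mem (by exact hω), mul_comm]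
  · have : (fun g => (g, t ω)) ⁻¹' (A ×ˢ B) = ∅ := by ext; simp [hω]
    rw [this, Set.indicator_of_notMem (by exact hω)]
    simp

/-- The product of independent uniform elements of two subgroups that commute elementwise. -/
theorem uniformOn_mul {G N X : Subgroup Γ} (hG : G ≤ X) (hN : N ≤ X)
    (hX : ∀ x ∈ X, ∃ y ∈ N, ∃ g ∈ G, x = y * g) (hc : ∀ g ∈ G, ∀ y ∈ N, g * y = y * g) :
    ((uniformOn G).bind fun g => (uniformOn N).map (· * g)) = uniformOn X := by
  set q := (uniformOn G).bind fun g => (uniformOn N).map (· * g) with hq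
  -- The law `q` is invariant under `N` because the factor from `N` can be moved past `g`, and under
  -- `G` directly; so it is invariant under all of `X`, and the invariance criterion with `f = id`
  -- and a trivial `t` identifies it.
  have hleft : ∀ y ∈ N, q.map (· * y) = q := fun y hy => by
    rw [hq, PMF.map_bind]
    refine PMF.bind_congr_support _ fun g hg => ?_
    conv_rhs => rw [← uniformOn_map_mul_right hy]
    rw [PMF.map_comp, PMF.map_comp]
    congr 1
    funext z
    simp [mul_assoc, hc g (mem_support_uniformOn.1 hg) y hy]
  have hright : ∀ g ∈ G, q.map (· * g) = q := fun g hg => by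
    conv_rhs => rw [hq, ← uniformOn_map_mul_right hg, PMF.bind_map]
    rw [hq, PMF.map_bind]
    congr 1
    funext x
    simp only [PMF.map_comp, Function.comp_def, mul_assoc]
  have := map_eq_uniformOn_of_invariant q id (fun _ => ()) X ?_ ?_
  · rwa [PMF.map_id] at this
  · intro ω hω
    simp only [hq, PMF.mem_support_bind_iff, PMF.mem_support_map_iff, mem_support_uniformOn] at hω
    obtain ⟨g, hg, y, hy, rfl⟩ := hω
    exact X.mul_mem (hN hy) (hG hg)
  · intro h hh
    obtain ⟨y, hy, g, hg, rfl⟩ := hX h hh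
    have h1 : q.map (· * (y * g)) = q := by
      conv_rhs => rw [← hright g hg, ← hleft y hy, PMF.map_comp]
      simp [Function.comp_def, mul_assoc]
    conv_rhs => rw [← h1, PMF.map_comp]
    rfl

end UniformOn

/-! ### Sequences of shuffles -/

section ShuffleLaw

variable {κ : Type u}
variable {lam : Type*} {ι σ : lam → Type*}

/-- The group of the permutations that permute the piles within each of the families `pile l`,
`l ∈ Ls`, and fix all other cards. -/
def pileScrambles (pile : ∀ l, ι l × σ l ↪ κ) (Ls : List lam) : Subgroup (Perm κ) where
  carrier := {g | (∃ π : ∀ l, Perm (ι l), ∀ l ∈ Ls, ∀ a r, g (pile l (a, r)) = pile l (π l a, r)) ∧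
    ∀ p, (∀ l ∈ Ls, p ∉ Set.range (pile l)) → g p = p}
  one_mem' := ⟨⟨fun _ => 1, fun _ _ _ _ => rfl⟩, fun _ _ => rfl⟩
  mul_mem' := by
    rintro g h ⟨⟨π, hπ⟩, hg⟩ ⟨⟨ρ, hρ⟩, hh⟩
    refine ⟨⟨fun l => π l * ρ l, fun l hl a r => ?_⟩, fun p hp => ?_⟩
    · rw [Perm.mul_apply, hρ l hl, hπ l hl, Perm.mul_apply]
    · rw [Perm.mul_apply, hh p hp, hg p hp]
  inv_mem' := by
    rintro g ⟨⟨π, hπ⟩, hg⟩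
    refine ⟨⟨fun l => (π l)⁻¹, fun l hl a r => ?_⟩, fun p hp => ?_⟩
    · rw [Perm.inv_eq_iff_eq, hπ l hl]
      exact congrArg (fun b => pile l (b, r)) ((π l).apply_symm_apply a).symm
    · rw [Perm.inv_eq_iff_eq, hg p hp]

variable {pile : ∀ l, ι l × σ l ↪ κ}

/-- Every choice of permutations of the piles is realized in `pileScrambles`. -/
theorem exists_mem_pileScrambles (hd : ∀ l l' x y, pile l x = pile l' y → l = l')
    (π : ∀ l, Perm (ι l)) (Ls : List lam) :
    ∃ g ∈ pileScrambles pile Ls, ∀ l ∈ Ls, ∀ a r, g (pile l (a, r)) = pile l (π l a, r) := by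
  -- By disjointness the families embed jointly, so a permutation of their disjoint union extends by
  -- the identity to all places.
  let E : (Σ l : {l // l ∈ Ls}, ι l × σ l) ↪ κ :=
    ⟨fun x => pile x.1 x.2, by
      rintro ⟨⟨l, hl⟩, x⟩ ⟨⟨l', hl'⟩, y⟩ h
      obtain rfl := hd _ _ _ _ h
      obtain rfl := (pile l).injective h
      rfl⟩
  let P : Perm (Σ l : {l // l ∈ Ls}, ι l × σ l) :=
    Equiv.sigmaCongrRight fun l => (π l).prodCongr (Equiv.refl _)
  have hg : ∀ l ∈ Ls, ∀ a r, P.viaEmbedding E (pile l (a, r)) = pile l (π l a, r) :=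
    fun l hl a r => P.viaEmbedding_apply E ⟨⟨l, hl⟩, (a, r)⟩
  refine ⟨P.viaEmbedding E, ⟨⟨π, hg⟩, fun p hp => ?_⟩, hg⟩
  refine P.viaEmbedding_apply_of_notMem E p ?_
  rintro ⟨⟨⟨l, hl⟩, x⟩, rfl⟩
  exact hp l hl ⟨x, rfl⟩

variable [Finite κ]

/-- The law of the total permutation of a sequence of uniform closed shuffles. -/
noncomputable def shuffleLaw : List (Subgroup (Perm κ)) → PMF (Perm κ)
  | [] => PMF.pure 1
  | G :: Gs => (uniformOn G).bind fun g => (shuffleLaw Gs).map (· * g)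

theorem shuffleLaw_append (Gs Gs' : List (Subgroup (Perm κ))) :
    shuffleLaw (Gs ++ Gs') = (shuffleLaw Gs).bind fun g => (shuffleLaw Gs').map (· * g) := by
  induction Gs with
  | nil =>
    rw [List.nil_append, shuffleLaw, PMF.pure_bind]
    exact (PMF.map_id _).symm
  | cons G Gs ih =>
    simp only [List.cons_append, shuffleLaw, ih, PMF.map_bind, PMF.bind_bind, PMF.bind_map,
      PMF.map_comp, Function.comp_def, mul_assoc]

/-- Pile-scramble shuffles of disjoint families of piles yield, in total, a uniformly distributed
element of `pileScrambles`. -/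
theorem shuffleLaw_map_pileScramble (hd : ∀ l l' x y, pile l x = pile l' y → l = l')
    (Ls : List lam) (hLs : Ls.Nodup) :
    shuffleLaw (Ls.map fun l => pileScramble (pile l)) = uniformOn (pileScrambles pile Ls) := by
  classical
  induction Ls with
  | nil =>
    have : ∀ g, g ∈ pileScrambles pile [] ↔ g = 1 := fun g =>
      ⟨fun h => Equiv.ext fun p => h.2 p (by simp), fun h => h ▸ one_mem _⟩
    ext g
    simp only [List.map_nil, shuffleLaw, uniformOn_apply, this, PMF.pure_apply]
    simp
  | cons l Ls ih =>
    rw [List.nodup_cons] at hLs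
    simp only [List.map_cons, shuffleLaw]
    rw [ih hLs.2]
    have hne : ∀ l' ∈ Ls, ∀ x y, pile l' x ≠ pile l y := fun l' hl' x y h =>
      hLs.1 (hd _ _ _ _ h ▸ hl')
    refine uniformOn_mul ?_ ?_ ?_ ?_
    · rintro g ⟨π, hπ, hg⟩
      refine ⟨⟨Function.update (fun _ => 1) l π, fun l' hl' a r => ?_⟩, fun p hp =>
        hg p (hp l (by simp))⟩
      obtain rfl | hl'' := List.mem_cons.1 hl'
      · simp [hπ]
      · have : l' ≠ l := by rintro rfl; exact hLs.1 hl''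
        rw [Function.update_of_ne this]
        refine hg _ ?_
        rintro ⟨y, hy⟩
        exact hne l' hl'' _ _ hy.symm
    · rintro g ⟨⟨π, hπ⟩, hg⟩
      refine ⟨⟨Function.update π l 1, fun l' hl' a r => ?_⟩, fun p hp =>
        hg p fun l' hl' => hp l' (by simp [hl'])⟩
      obtain rfl | hl'' := List.mem_cons.1 hl'
      · simp only [Function.update_self, Perm.one_apply]
        refine hg _ fun l'' hl'' => ?_
        rintro ⟨y, hy⟩
        exact hne l'' hl'' _ _ hy
      · have : l' ≠ l := by rintro rfl; exact hLs.1 hl''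
        rw [Function.update_of_ne this, hπ l' hl'']
    · rintro x ⟨⟨π, hπ⟩, hx⟩
      -- `y` copies the action of `x` on the families in `Ls`; what remains, `y⁻¹ * x`, moves only
      -- the family `l`.
      obtain ⟨y, hy, hyπ⟩ := exists_mem_pileScrambles hd π Ls
      refine ⟨y, hy, y⁻¹ * x, ⟨π l, fun a r => ?_, fun p hp => ?_⟩, by group⟩
      · rw [Perm.mul_apply, hπ l (by simp), Perm.inv_eq_iff_eq]
        refine (hy.2 _ fun l'' hl'' => ?_).symm
        rintro ⟨y, hy⟩
        exact hne l'' hl'' _ _ hy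
      · rw [Perm.mul_apply, Perm.inv_eq_iff_eq]
        by_cases hp' : ∃ l' ∈ Ls, p ∈ Set.range (pile l')
        · obtain ⟨l', hl', ⟨a, r⟩, rfl⟩ := hp'
          rw [hπ l' (by simp [hl']), hyπ l' hl']
        · push Not at hp'
          rw [hy.2 p hp']
          refine hx p fun l' hl' => ?_
          obtain rfl | hl' := List.mem_cons.1 hl'
          · exact hp
          · exact hp' l' hl'
    · rintro g ⟨ρ, -, hg⟩ y hy
      refine Perm.Disjoint.commute fun p => ?_
      by_cases hp : p ∈ Set.range (pile l)
      · obtain ⟨x, rfl⟩ := hp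
        refine Or.inr (hy.2 _ fun l'' hl'' => ?_)
        rintro ⟨y, hy⟩
        exact hne l'' hl'' _ _ hy
      · exact Or.inl (hg p hp)

end ShuffleLaw

/-! ### Runs of consecutive shuffles. -/

section Run

variable {κ : Type u} {S : Type v} [Fintype κ]

theorem act_turn_of_up_eq (sym : κ → S) (c : Config κ S) {T : Finset κ} (hc : c.up = T) :
    act sym c (.turn T) = PMF.pure (c.next sym (.turn T) c.card ∅) := by
  classical
  rw [act, hc]
  exact congrArg (fun U => PMF.pure (c.next sym (.turn T) c.card U)) (symmDiff_self T)

theorem act_turn_of_up_eq_empty (sym : κ → S) (c : Config κ S) {T : Finset κ} (hc : c.up = ∅) :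
    act sym c (.turn T) = PMF.pure (c.next sym (.turn T) c.card T) := by
  classical
  rw [act, hc]
  exact congrArg (fun U => PMF.pure (c.next sym (.turn T) c.card U)) (bot_symmDiff T)

/-- Shuffles of face-down cards are performed unseen. -/
theorem run_shuffles (sym : κ → S) (Gs : List (Subgroup (Perm κ))) (P : Protocol κ S)
    (c : Config κ S) (hc : c.up = ∅) :
    run sym (Gs.map (fun G _ => .shuffle G) ++ P) c = (shuffleLaw Gs).bind fun g =>
      run sym P ⟨c.card * g⁻¹, ∅, List.replicate Gs.length (fun _ => none) ++ c.trace,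
        (Gs.map .shuffle).reverse ++ c.log⟩ := by
  classical
  induction Gs generalizing c with
  | nil =>
    obtain ⟨card, up, trace, log⟩ := c
    obtain rfl : up = ∅ := hc
    simp [shuffleLaw]
  | cons G Gs ih =>
    have hact : act sym c (.shuffle G) =
        (uniformOn G).map fun g => c.move sym (.shuffle G) g := by
      rw [act]
      exact congrArg (PMF.map _) (map_uniformOfFintype G id |>.trans (PMF.map_id _))
    simp only [List.map_cons, List.cons_append, run, hact, PMF.bind_map, shuffleLaw, PMF.bind_bind]
    congr 1
    funext g
    have hvis : visible sym (c.card * g⁻¹) ∅ = fun _ => none := by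
      funext p
      simp [visible]
    rw [Function.comp_apply, ih _ (by simp [Config.move, Config.next, hc])]
    congr 1
    funext x
    simp [Config.move, Config.next, hc, mul_assoc, hvis, List.replicate_succ']

end Run

end CardBased

/-! ### The three groups of shuffles and the action of an automorphism on the places. -/

namespace FinHypergraph

open CardBased

variable {n m : ℕ} {S : Type*} (H : FinHypergraph n m)

/-- The hyperedge to which the card that lies at a place at the beginning belongs. -/
def edgeOf : H.Place → Option (Fin m) := Sum.elim (fun _ => none) fun w => some w.1.2

/-- The vertex pile to which a place belongs. -/
def vertexOf : H.Place → Fin n := Sum.elim id fun w => w.1.1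

variable {H}

@[simp] theorem edgeOf_inr (w : H.Slot) : H.edgeOf (.inr w) = some w.1.2 := rfl

theorem exists_edgePile_eq (w : H.Slot) :
    ∃ r, H.edgePile (H.edge w.1.2).card (⟨w.1.2, rfl⟩, r) = .inr w := by
  obtain ⟨⟨i, j⟩, hw⟩ := w
  have : i ∈ Set.range ((H.edge j).orderEmbOfFin rfl) := by
    rw [Finset.range_orderEmbOfFin]; exact hw
  obtain ⟨r, hr⟩ := this
  refine ⟨r, congrArg Sum.inr (Subtype.ext (Prod.ext hr rfl))⟩

theorem exists_vertexPile_eq (w : H.Slot) :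
    ∃ r, H.vertexPile (H.incident w.1.1).card (⟨w.1.1, rfl⟩, some r) = .inr w := by
  obtain ⟨⟨i, j⟩, hw⟩ := w
  have : j ∈ Set.range ((H.incident i).orderEmbOfFin rfl) := by
    rw [Finset.range_orderEmbOfFin]; exact Finset.mem_filter.2 ⟨Finset.mem_univ _, hw⟩
  obtain ⟨r, hr⟩ := this
  refine ⟨r, congrArg Sum.inr (Subtype.ext (Prod.ext rfl hr))⟩

theorem edgePile_disjoint (s s' : ℕ) (x y) (h : H.edgePile s x = H.edgePile s' y) : s = s' := by
  have : x.1.1 = y.1.1 := Option.some_injective _ (congrArg H.edgeOf h)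
  rw [← x.1.2, ← y.1.2, this]

theorem vertexOf_vertexPile (d : ℕ) (x) : H.vertexOf (H.vertexPile d x) = x.1.1 := by
  obtain ⟨i, _ | r⟩ := x <;> rfl

theorem vertexPile_disjoint (d d' : ℕ) (x y) (h : H.vertexPile d x = H.vertexPile d' y) :
    d = d' := by
  have : x.1.1 = y.1.1 := by
    simpa only [vertexOf_vertexPile] using congrArg H.vertexOf h
  rw [← x.1.2, ← y.1.2, this]

theorem vertexCards_disjoint (i i' : Fin n) (x y) (h : H.vertexCards i x = H.vertexCards i' y) :
    i = i' :=
  congrArg H.vertexOf h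

theorem mem_sizes (j : Fin m) : (H.edge j).card ∈ H.sizes.toList := by
  simp [sizes]

theorem mem_degrees (i : Fin n) : (H.incident i).card ∈ H.degrees.toList := by
  simp [degrees]

/-- The permutation of a type whose restrictions to the fibres of `f` are given. -/
def _root_.Equiv.Perm.ofFibers {α β : Type*} (f : α → β) (π : ∀ b, Perm {a // f a = b}) : Perm α :=
  (Equiv.sigmaFiberEquiv f).symm.trans
    ((Equiv.sigmaCongrRight π).trans (Equiv.sigmaFiberEquiv f))

variable (H) in
/-- The total permutations of the shuffles of the edge piles. -/
noncomputable def edgeGroup : Subgroup (Perm H.Place) := pileScrambles H.edgePile H.sizes.toList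

variable (H) in
/-- The total permutations of the shuffles inside the vertex piles. -/
def cardGroup : Subgroup (Perm H.Place) := pileScrambles H.vertexCards (List.finRange n)

variable (H) in
/-- The total permutations of the shuffles of the vertex piles. -/
noncomputable def vertexGroup : Subgroup (Perm H.Place) := pileScrambles H.vertexPile H.degrees.toList

theorem edgeGroup_apply_inl {g : Perm H.Place} (hg : g ∈ H.edgeGroup) (i : Fin n) :
    g (.inl i) = .inl i :=
  hg.2 _ fun s _ => by rintro ⟨x, hx⟩; cases hx

/-- Piles move as wholes within each size class, so the permutations of the classes glue to a single
permutation of the hyperedge indices. -/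
theorem exists_edgeOf_of_mem {g : Perm H.Place} (hg : g ∈ H.edgeGroup) :
    ∃ ρ : Perm (Fin m), ∀ p, H.edgeOf (g p) = (H.edgeOf p).map ρ := by
  obtain ⟨π, hπ⟩ := hg.1
  refine ⟨Perm.ofFibers (fun j => (H.edge j).card) π, ?_⟩
  rintro (i | w)
  · rw [edgeGroup_apply_inl hg]; rfl
  · obtain ⟨r, hr⟩ := exists_edgePile_eq w
    rw [← hr, hπ _ (mem_sizes _)]
    rfl

theorem exists_mem_edgeGroup (σ : Perm (Fin m)) (hσ : ∀ j, (H.edge (σ j)).card = (H.edge j).card) :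
    ∃ g ∈ H.edgeGroup, ∀ p, H.edgeOf (g p) = (H.edgeOf p).map σ := by
  obtain ⟨g, hg, h⟩ := exists_mem_pileScrambles (edgePile_disjoint (H := H))
    (fun s => σ.subtypePerm (p := fun j => (H.edge j).card = s) fun j => by rw [hσ])
    H.sizes.toList
  refine ⟨g, hg, ?_⟩
  rintro (i | w)
  · rw [edgeGroup_apply_inl hg]; rfl
  · obtain ⟨r, hr⟩ := exists_edgePile_eq w
    rw [← hr, h _ (mem_sizes _)]
    rfl

theorem exists_vertexOf_of_mem {g : Perm H.Place} (hg : g ∈ H.vertexGroup) :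
    ∃ τ : Perm (Fin n), (∀ i, g (.inl i) = .inl (τ i)) ∧
      ∀ p, H.vertexOf (g p) = τ (H.vertexOf p) := by
  obtain ⟨π, hπ⟩ := hg.1
  refine ⟨Perm.ofFibers (fun i => (H.incident i).card) π, ?_, ?_⟩
  -- The index `none` stands for the first card of a vertex pile, which stays first when piles are
  -- permuted.
  · exact fun i => hπ _ (mem_degrees i) ⟨i, rfl⟩ none
  · rintro (i | w)
    · exact congrArg H.vertexOf (hπ _ (mem_degrees i) ⟨i, rfl⟩ none)
    · obtain ⟨r, hr⟩ := exists_vertexPile_eq w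
      rw [← hr, hπ _ (mem_degrees _), vertexOf_vertexPile, vertexOf_vertexPile]
      rfl

theorem exists_mem_vertexGroup (τ : Perm (Fin n))
    (hτ : ∀ i, (H.incident (τ i)).card = (H.incident i).card) :
    ∃ g ∈ H.vertexGroup, (∀ i, g (.inl i) = .inl (τ i)) ∧
      ∀ p, H.vertexOf (g p) = τ (H.vertexOf p) := by
  obtain ⟨g, hg, h⟩ := exists_mem_pileScrambles (vertexPile_disjoint (H := H))
    (fun d => τ.subtypePerm (p := fun i => (H.incident i).card = d) fun j => by rw [hτ])
    H.degrees.toList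
  have hgτ : ∀ i, g (.inl i) = .inl (τ i) := fun i => h _ (mem_degrees i) ⟨i, rfl⟩ none
  obtain ⟨τ', h1, h2⟩ := exists_vertexOf_of_mem hg
  have : τ' = τ := Equiv.ext fun i => Sum.inl_injective ((h1 i).symm.trans (hgτ i))
  exact ⟨g, hg, hgτ, this ▸ h2⟩

/-- Since the piles inside a vertex pile are single cards, no order is to be preserved: fixing the
first cards and respecting `vertexOf` is enough. This makes membership of conjugates and of `u⁻¹ *
placePerm h` easy to test. -/
theorem mem_cardGroup_iff {g : Perm H.Place} :
    g ∈ H.cardGroup ↔ (∀ i, g (.inl i) = .inl i) ∧ ∀ p, H.vertexOf (g p) = H.vertexOf p := by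
  constructor
  · intro hg
    have hi : ∀ i, g (.inl i) = .inl i := fun i =>
      hg.2 _ fun s _ => by rintro ⟨x, hx⟩; cases hx
    obtain ⟨π, hπ⟩ := hg.1
    refine ⟨hi, ?_⟩
    rintro (i | ⟨⟨i, j⟩, hj⟩)
    · rw [hi]
    · have := congrArg H.vertexOf (hπ i (List.mem_finRange i) ⟨j, hj⟩ 0)
      exact this
  · rintro ⟨hi, hv⟩
    have hinr : ∀ (i : Fin n) (j : {j : Fin m // i ∈ H.edge j}),
        ∃ j' : {j : Fin m // i ∈ H.edge j}, g (.inr ⟨(i, j.1), j.2⟩) = .inr ⟨(i, j'.1), j'.2⟩ := by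
      intro i j
      have h1 := hv (.inr ⟨(i, j.1), j.2⟩)
      rcases h2 : g (.inr ⟨(i, j.1), j.2⟩) with k | ⟨⟨i', j'⟩, hj'⟩
      · rw [← hi k] at h2
        exact absurd (g.injective h2) (by simp)
      · rw [h2] at h1
        obtain rfl : i' = i := h1
        exact ⟨⟨j', hj'⟩, rfl⟩
    choose π hπ using hinr
    have hinj : ∀ i, Function.Injective (π i) := by
      intro i j j' hjj
      have := (hπ i j).trans (hjj ▸ (hπ i j').symm)
      simpa [Subtype.ext_iff] using g.injective this
    refine ⟨⟨fun i => Equiv.ofBijective (π i) (Finite.injective_iff_bijective.1 (hinj i)),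
      fun i _ j r => hπ i j⟩, ?_⟩
    rintro (i | ⟨⟨i, j⟩, hj⟩) hp
    · exact hi i
    · exact absurd ⟨(⟨j, hj⟩, 0), rfl⟩ (hp i (List.mem_finRange i))

/-- `σ` maps the hyperedges at `i` bijectively onto those at `f i`. Thus `f` only permutes vertex
piles of equal size and is realized in `vertexGroup`. -/
theorem incident_card_eq {f : Perm (Fin n)} {σ : Perm (Fin m)}
    (h : ∀ j, (H.edge j).map f.toEmbedding = H.edge (σ j)) (i : Fin n) :
    (H.incident (f i)).card = (H.incident i).card := by
  rw [← Finset.card_map σ.toEmbedding (s := H.incident i)]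
  congr 1
  ext j
  obtain ⟨j, rfl⟩ := σ.surjective j
  simp [incident, ← h]

/-- The permutation of the places that is induced by an automorphism. -/
def placePerm {f : Perm (Fin n)} {σ : Perm (Fin m)}
    (h : ∀ j, (H.edge j).map f.toEmbedding = H.edge (σ j)) : Perm H.Place :=
  f.sumCongr ((f.prodCongr σ).subtypeEquiv fun p => by simp [← h])

/-- The core of the security proof: right multiplication by an automorphism `f` on the level of
the input cards is achieved by a measure-preserving change of the three shuffles, up to a
permutation of helping cards with equal symbols. -/
theorem exists_translation {f : Perm (Fin n)} (hf : f ∈ H.aut) :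
    ∃ s ∈ H.edgeGroup, ∃ u ∈ H.vertexGroup, ∃ t ∈ H.cardGroup,
      (∀ b, u⁻¹ * b * u ∈ H.cardGroup ↔ b ∈ H.cardGroup) ∧
      ∀ a ∈ H.edgeGroup, ∀ b d : Perm H.Place, ∃ ε : Perm H.Place,
        (∀ i, ε (.inl i) = .inl (f i)) ∧ (∀ p, H.edgeOf (ε p) = H.edgeOf p) ∧
        d * u * (u⁻¹ * b * u * t) * (s * a) = d * b * a * ε := by
  obtain ⟨σ, h⟩ := hf
  obtain ⟨s, hs, hsσ⟩ := exists_mem_edgeGroup σ fun j => by rw [← h, Finset.card_map]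
  obtain ⟨u, hu, hui, huv⟩ := exists_mem_vertexGroup f (incident_card_eq h)
  have hpi : ∀ i, placePerm h (.inl i) = .inl (f i) := fun _ => rfl
  have hpv : ∀ p, H.vertexOf (placePerm h p) = f (H.vertexOf p) := by rintro (i | w) <;> rfl
  have hpe : ∀ p, H.edgeOf (placePerm h p) = (H.edgeOf p).map σ := by rintro (i | w) <;> rfl
  have hui' : ∀ i, u⁻¹ (.inl (f i)) = .inl i := fun i => by rw [Perm.inv_eq_iff_eq, hui]
  have huv' : ∀ p, f (H.vertexOf (u⁻¹ p)) = H.vertexOf p := fun p =>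
    (huv _).symm.trans (congrArg _ (u.apply_symm_apply p))
  -- Both `u` and `placePerm h` carry the vertex pile `i` to the vertex pile `f i`, but with
  -- different orders inside; their quotient therefore lies in `cardGroup`.
  refine ⟨s⁻¹, inv_mem hs, u, hu, u⁻¹ * placePerm h, ?_, ?_, ?_⟩
  · refine mem_cardGroup_iff.2 ⟨fun i => ?_, fun p => ?_⟩
    · rw [Perm.mul_apply, hpi, hui']
    · apply f.injective
      rw [Perm.mul_apply, huv', hpv]
  · intro b
    rw [mem_cardGroup_iff, mem_cardGroup_iff]
    constructor
    · rintro ⟨h1, h2⟩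
      refine ⟨fun i => ?_, fun p => ?_⟩
      · obtain ⟨i, rfl⟩ := f.surjective i
        have := h1 i
        rwa [Perm.mul_apply, Perm.mul_apply, Perm.inv_eq_iff_eq, hui] at this
      · obtain ⟨p, rfl⟩ := u.surjective p
        have := congrArg f (h2 p)
        rwa [Perm.mul_apply, Perm.mul_apply, huv', ← huv] at this
    · rintro ⟨h1, h2⟩
      refine ⟨fun i => ?_, fun p => ?_⟩
      · rw [Perm.mul_apply, Perm.mul_apply, hui, h1, hui']
      · apply f.injective
        rw [Perm.mul_apply, Perm.mul_apply, huv', h2, huv]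
  · intro a ha b d
    obtain ⟨ρ, hρ⟩ := exists_edgeOf_of_mem ha
    have hρ' : ∀ p, (H.edgeOf (a⁻¹ p)).map ρ = H.edgeOf p := fun p =>
      (hρ _).symm.trans (congrArg _ (a.apply_symm_apply p))
    have hsσ' : ∀ p, (H.edgeOf (s⁻¹ p)).map σ = H.edgeOf p := fun p =>
      (hsσ _).symm.trans (congrArg _ (s.apply_symm_apply p))
    -- This `ε` is forced by the required equation. On hyperedge indices its factors contribute `ρ`,
    -- `σ⁻¹`, `σ`, `ρ⁻¹` in order of application, which cancel; on input cards only `placePerm h`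
    -- acts.
    refine ⟨a⁻¹ * placePerm h * s⁻¹ * a, fun i => ?_, fun p => ?_, by group⟩
    · simp only [Perm.mul_apply]
      rw [edgeGroup_apply_inl ha, edgeGroup_apply_inl (inv_mem hs), hpi,
        edgeGroup_apply_inl (inv_mem ha)]
    · apply Option.map_injective ρ.injective
      simp only [Perm.mul_apply]
      rw [hρ', hpe, hsσ', hρ]

end FinHypergraph

/-! ### Permutations that keep input places and helping places apart. -/

namespace CardBased

universe u v

variable {V W : Type u} {S : Type v}

/-- The places of the input cards determine the permutation, so the arbitrary choice in `outPerm` is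
harmless. -/
theorem Config.outPerm_eq {c : Config (V ⊕ W) S} {g : Perm V} (h : c.Permutes g) :
    c.outPerm = g := by
  have hex : ∃ g, c.Permutes g := ⟨g, h⟩
  rw [Config.outPerm, dif_pos hex]
  exact Equiv.ext fun i => Sum.inl_injective (c.card.injective ((hex.choose_spec i).trans (h i).symm))

theorem visible_helpPlaces_inl [Fintype W] (sym : V ⊕ W → S) (card : Perm (V ⊕ W)) (i : V) :
    visible sym card (helpPlaces V W) (.inl i) = none := by
  simp [visible, helpPlaces]

theorem visible_helpPlaces_inr [Fintype W] (sym : V ⊕ W → S) (card : Perm (V ⊕ W)) (w : W) :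
    visible sym card (helpPlaces V W) (.inr w) = some (sym (card (.inr w))) := by
  simp [visible, helpPlaces]

/-- A permutation that permutes the places `V` also permutes the places `W`. -/
theorem exists_apply_inr {g : Perm (V ⊕ W)} {τ : Perm V} (h : ∀ i, g (.inl i) = .inl (τ i)) (w : W) :
    ∃ w', g (.inr w) = .inr w' := by
  rcases hg : g (.inr w) with i | w'
  · have := hg.trans ((congrArg Sum.inl (τ.apply_symm_apply i)).symm.trans (h (τ.symm i)).symm)
    exact absurd (g.injective this) (by simp)
  · exact ⟨w', rfl⟩

theorem inv_apply_inl {g : Perm (V ⊕ W)} {τ : Perm V} (h : ∀ i, g (.inl i) = .inl (τ i)) (i : V) :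
    g⁻¹ (.inl i) = .inl (τ⁻¹ i) := by
  rw [Perm.inv_eq_iff_eq, h]
  exact congrArg Sum.inl (τ.apply_symm_apply i).symm

theorem map_helpPlaces [Fintype W] {g : Perm (V ⊕ W)} {τ : Perm V} (h : ∀ i, g (.inl i) = .inl (τ i)) :
    (helpPlaces V W).map g.toEmbedding = helpPlaces V W := by
  refine Finset.eq_of_subset_of_card_le ?_ (Finset.card_map _).ge
  intro p hp
  simp only [helpPlaces, Finset.mem_map, Finset.mem_univ, true_and] at hp
  obtain ⟨_, ⟨w, rfl⟩, rfl⟩ := hp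
  obtain ⟨w', hw'⟩ := exists_apply_inr h w
  simp only [helpPlaces, Finset.mem_map, Finset.mem_univ, true_and]
  exact ⟨w', hw'.symm⟩

end CardBased

/-! ### The law of the protocol, its completion and its security. -/

namespace FinHypergraph

open CardBased

universe v

variable {n m : ℕ} {S : Type v} (H : FinHypergraph n m)

/-- The groups of the shuffles of the protocol. -/
noncomputable def shuffles : List (Subgroup (Perm H.Place)) :=
  H.sizes.toList.map (fun s => pileScramble (H.edgePile s))
    ++ ((List.finRange n).map (fun i => pileScramble (H.vertexCards i))
    ++ H.degrees.toList.map (fun d => pileScramble (H.vertexPile d)))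

theorem length_shuffles : H.shuffles.length = n + H.degrees.card + H.sizes.card := by
  simp [shuffles]
  omega

theorem protocolOpen_eq : H.protocolOpen S = (fun _ => .turn (helpPlaces _ _)) ::
    (H.shuffles.map (fun G _ => .shuffle G) ++ [fun _ => .turn (helpPlaces _ _)]) := by
  simp [protocolOpen, shuffles, Function.comp_def]

theorem shuffleLaw_shuffles : shuffleLaw H.shuffles = (uniformOn H.edgeGroup).bind fun a =>
    (uniformOn H.cardGroup).bind fun b => (uniformOn H.vertexGroup).map fun d => d * b * a := by
  have hA : shuffleLaw (H.sizes.toList.map fun s => pileScramble (H.edgePile s)) =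
      uniformOn H.edgeGroup :=
    shuffleLaw_map_pileScramble edgePile_disjoint _ (Finset.nodup_toList _)
  have hB : shuffleLaw ((List.finRange n).map fun i => pileScramble (H.vertexCards i)) =
      uniformOn H.cardGroup :=
    shuffleLaw_map_pileScramble vertexCards_disjoint _ (List.nodup_finRange _)
  have hD : shuffleLaw (H.degrees.toList.map fun d => pileScramble (H.vertexPile d)) =
      uniformOn H.vertexGroup :=
    shuffleLaw_map_pileScramble vertexPile_disjoint _ (Finset.nodup_toList _)
  rw [shuffles, shuffleLaw_append, shuffleLaw_append, hA, hB, hD]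
  simp only [PMF.map_bind, PMF.map_comp, Function.comp_def]

variable {H}

theorem mem_support_shuffleLaw {g : Perm H.Place} : g ∈ (shuffleLaw H.shuffles).support ↔
    ∃ a ∈ H.edgeGroup, ∃ b ∈ H.cardGroup, ∃ d ∈ H.vertexGroup, d * b * a = g := by
  simp only [shuffleLaw_shuffles, PMF.mem_support_bind_iff, PMF.mem_support_map_iff,
    mem_support_uniformOn]

/-- Change of variables: `a ↦ s * a`, `b ↦ u⁻¹ * b * u * t` and `d ↦ d * u` each preserve the
uniform law of the respective group. -/
theorem map_shuffleLaw_eq {Y : Type*} {F G : Perm H.Place → Y} {s u t : Perm H.Place}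
    (hs : s ∈ H.edgeGroup) (hu : u ∈ H.vertexGroup) (ht : t ∈ H.cardGroup)
    (hut : ∀ b, u⁻¹ * b * u ∈ H.cardGroup ↔ b ∈ H.cardGroup)
    (h : ∀ a ∈ H.edgeGroup, ∀ b ∈ H.cardGroup, ∀ d ∈ H.vertexGroup,
      F (d * b * a) = G (d * u * (u⁻¹ * b * u * t) * (s * a))) :
    (shuffleLaw H.shuffles).map F = (shuffleLaw H.shuffles).map G := by
  have hB : (uniformOn H.cardGroup).map (fun b => u⁻¹ * b * u * t) = uniformOn H.cardGroup := by
    refine uniformOn_map_equiv _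
      (((Equiv.mulLeft u⁻¹).trans (Equiv.mulRight u)).trans (Equiv.mulRight t)) fun b => ?_
    exact (mul_mem_cancel_right ht).trans (hut b)
  conv_rhs => rw [shuffleLaw_shuffles, ← uniformOn_map_mul_left hs, ← hB,
    ← uniformOn_map_mul_right hu]
  rw [shuffleLaw_shuffles]
  simp only [PMF.map_bind, PMF.bind_map, PMF.map_comp, Function.comp_def]
  refine PMF.bind_congr_support _ fun a ha => PMF.bind_congr_support _ fun b hb =>
    PMF.map_congr_support _ fun d hd => ?_
  rw [mem_support_uniformOn] at ha hb hd
  exact h a ha b hb d hd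

variable (num : Fin m ↪ S) (x : Fin n → S)

variable (H) in
/-- The symbols of all cards. -/
abbrev symbols : H.Place → S := Sum.elim x (H.helpSymbol num)

theorem symbols_eq {p : H.Place} {j : Fin m} (h : H.edgeOf p = some j) :
    H.symbols num x p = num j := by
  rcases p with i | w
  · cases h
  · exact congrArg num (Option.some_injective _ h)

variable (H) in
/-- The symbols that are opened if the cards have been permuted by `g`. -/
noncomputable def openedSymbols (g : Perm H.Place) : Visible H.Place S :=
  visible (H.symbols num x) g⁻¹ (helpPlaces _ _)

theorem openedSymbols_inl (g : Perm H.Place) (i : Fin n) :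
    H.openedSymbols num x g (.inl i) = none := visible_helpPlaces_inl _ _ _

theorem openedSymbols_inr (g : Perm H.Place) (w : H.Slot) :
    H.openedSymbols num x g (.inr w) = some (H.symbols num x (g⁻¹ (.inr w))) :=
  visible_helpPlaces_inr _ _ _

/-- The properties of the total permutations that make the last step possible. -/
def IsRegular (g : Perm H.Place) (τ : Perm (Fin n)) : Prop :=
  (∀ i, g (.inl i) = .inl (τ i)) ∧ τ ∈ H.Iso (H.opened num (H.openedSymbols num x g))

/-- The vertex pile formed at `i` receives the symbol `j` iff `i` lies in the hyperedge `ρ j`, and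
`b` keeps it in that pile. So the opened `j`-th hyperedge is the image under `τ` of the hyperedge `ρ
j` of `H`. -/
theorem exists_isRegular {g : Perm H.Place} (hg : g ∈ (shuffleLaw H.shuffles).support) :
    ∃ τ, IsRegular num x g τ := by
  obtain ⟨a, ha, b, hb, d, hd, rfl⟩ := mem_support_shuffleLaw.1 hg
  obtain ⟨ρ, hρ⟩ := exists_edgeOf_of_mem ha
  rw [mem_cardGroup_iff] at hb
  obtain ⟨τ, hτ, hdv⟩ := exists_vertexOf_of_mem hd
  have hi : ∀ i, (d * b * a) (.inl i) = .inl (τ i) := fun i => by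
    rw [Perm.mul_apply, Perm.mul_apply, edgeGroup_apply_inl ha, hb.1, hτ]
  refine ⟨τ, hi, ρ⁻¹, fun j => ?_⟩
  obtain ⟨j, rfl⟩ := ρ.surjective j
  have hj : ρ⁻¹ (ρ j) = j := ρ.symm_apply_apply j
  rw [hj]
  ext k
  simp only [opened, Finset.mem_map, Finset.mem_filter, Finset.mem_univ, true_and,
    openedSymbols_inr, Option.some_inj, Equiv.coe_toEmbedding]
  constructor
  · rintro ⟨i, hij, rfl⟩
    -- `u` is the original place of the helping card that `a` brings to `(i, ρ j)`; that card bears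
    -- the symbol of `j`.
    obtain ⟨u, hu⟩ := exists_apply_inr (inv_apply_inl (τ := 1) (edgeGroup_apply_inl ha))
      ⟨(i, ρ j), hij⟩
    have hau : a (.inr u) = .inr ⟨(i, ρ j), hij⟩ := (Perm.inv_eq_iff_eq.1 hu).symm
    obtain ⟨⟨⟨k, j'⟩, hk⟩, hw⟩ := exists_apply_inr hi u
    have hkv : H.vertexOf ((d * b * a) (.inr u)) = τ i := by
      rw [Perm.mul_apply, Perm.mul_apply, hdv, hb.2, hau]
      rfl
    rw [hw] at hkv
    obtain rfl : k = τ i := hkv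
    refine ⟨j', hk, ?_⟩
    rw [Perm.inv_eq_iff_eq.2 hw.symm]
    refine symbols_eq num x ?_
    have := hρ (.inr u)
    rw [hau] at this
    simpa using this.symm
  · rintro ⟨j', hk, hs⟩
    obtain ⟨u, hu⟩ := exists_apply_inr (inv_apply_inl hi) ⟨(k, j'), hk⟩
    rw [hu] at hs
    obtain rfl : u.1.2 = j := num.injective hs
    have hgu := (Perm.inv_eq_iff_eq.1 hu)
    obtain ⟨⟨⟨i, j''⟩, hi⟩, hau⟩ := exists_apply_inr (τ := 1) (edgeGroup_apply_inl ha) u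
    have h1 := hρ (.inr u)
    rw [hau] at h1
    obtain rfl : j'' = ρ u.1.2 := Option.some_injective _ h1
    refine ⟨i, hi, ?_⟩
    have := congrArg H.vertexOf hgu
    rw [Perm.mul_apply, Perm.mul_apply, hdv, hb.2, hau] at this
    exact this.symm

variable {num x}

/-- Undoing all shuffles is an admissible last step. It depends on the unseen `g`, but it only
serves to show that admissible moves exist, which obliges the rule to select one. -/
theorem IsRegular.isFinalMove {g : Perm H.Place} {τ : Perm (Fin n)} (h : IsRegular num x g τ) :
    H.IsFinalMove num (H.openedSymbols num x g) g⁻¹ := by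
  refine ⟨τ, h.2, fun i => by rw [Perm.inv_eq_iff_eq, h.1], fun w => ?_⟩
  obtain ⟨w', hw'⟩ := exists_apply_inr h.1 w
  rw [inv_inv, hw', openedSymbols_inr, ← hw']
  exact congrArg some (congrArg (H.symbols num x) (g.symm_apply_apply _))

/-- Opened symbols do not change under a permutation of cards with equal symbols. -/
theorem openedSymbols_mul {g ε : Perm H.Place} {τ : Perm (Fin n)}
    (h : ∀ i, g (.inl i) = .inl (τ i)) (hε : ∀ p, H.edgeOf (ε p) = H.edgeOf p) :
    H.openedSymbols num x (g * ε) = H.openedSymbols num x g := by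
  funext p
  rcases p with i | w
  · rw [openedSymbols_inl, openedSymbols_inl]
  · rw [openedSymbols_inr, openedSymbols_inr, mul_inv_rev, Perm.mul_apply]
    obtain ⟨u, hu⟩ := exists_apply_inr (inv_apply_inl h) w
    rw [hu]
    refine congrArg some ((symbols_eq num x (j := u.1.2) ?_).trans (symbols_eq num x rfl).symm)
    rw [← hε]
    exact congrArg H.edgeOf (ε.apply_symm_apply _)

variable (H num x) in
/-- The configuration after the opening of the symbols, if the cards have been permuted by `g`. -/
noncomputable def openConfig (g : Perm H.Place) : Config H.Place S :=
  ⟨g⁻¹, helpPlaces _ _, H.openedSymbols num x g ::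
    (List.replicate H.shuffles.length (fun _ => none) ++
      [fun _ => none, visible (H.symbols num x) 1 (helpPlaces _ _)]),
    .turn (helpPlaces _ _) :: ((H.shuffles.map .shuffle).reverse ++ [.turn (helpPlaces _ _)])⟩

variable (H num x) in
/-- The final configuration. -/
noncomputable def finalConfig (rule : List (Visible H.Place S) → Perm H.Place) (g : Perm H.Place) :
    Config H.Place S :=
  (H.openConfig num x g).move (H.symbols num x) (.perm (rule (H.openConfig num x g).trace))
    (rule (H.openConfig num x g).trace)

theorem exec_protocolOpen_append (P : Protocol H.Place S) :
    exec (H.protocolOpen S ++ P) (H.helpSymbol num) x =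
      (shuffleLaw H.shuffles).bind fun g => run (H.symbols num x) P (H.openConfig num x g) := by
  have hvis : visible (H.symbols num x) 1 ∅ = fun _ => none := by
    funext p
    simp [visible]
  rw [protocolOpen_eq, exec, List.cons_append, run, List.append_assoc,
    act_turn_of_up_eq _ _ (T := helpPlaces _ _) rfl,
    PMF.pure_bind, run_shuffles _ _ _ _ rfl]
  congr 1
  funext g
  rw [List.singleton_append, run, act_turn_of_up_eq_empty _ _ rfl, PMF.pure_bind]
  simp [Config.next, Config.initial, openConfig, openedSymbols, hvis]

theorem exec_protocolOpen : exec (H.protocolOpen S) (H.helpSymbol num) x =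
    (shuffleLaw H.shuffles).map (H.openConfig num x) := by
  have := exec_protocolOpen_append (H := H) (num := num) (x := x) []
  rwa [List.append_nil] at this

theorem exec_protocol (rule : List (Visible H.Place S) → Perm H.Place) :
    exec (H.protocol rule) (H.helpSymbol num) x =
      (shuffleLaw H.shuffles).map (H.finalConfig num x rule) := by
  rw [protocol, exec_protocolOpen_append]
  simp only [run, act, PMF.bind_pure]
  rfl

variable {rule : List (Visible H.Place S) → Perm H.Place}

theorem finalConfig_spec (hr : H.IsFinalRule num rule) {g : Perm H.Place} {τ : Perm (Fin n)}
    (h : IsRegular num x g τ) :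
    (∃ f ∈ H.aut, (H.finalConfig num x rule g).Permutes f) ∧
    (H.finalConfig num x rule g).up = helpPlaces _ _ ∧
    ∀ w, H.symbols num x ((H.finalConfig num x rule g).card (.inr w)) = H.helpSymbol num w := by
  obtain ⟨ψ, ⟨σ, hσ⟩, hi, hw⟩ := hr (H.openedSymbols num x g) _ ⟨_, h.isFinalMove⟩
  obtain ⟨hgi, ⟨σ', hσ'⟩⟩ := h
  change ∀ i, (rule (H.openConfig num x g).trace) _ = _ at hi
  change ∀ w, _ = _ at hw
  have hi' : ∀ i, rule (H.openConfig num x g).trace (.inl i) = .inl (ψ⁻¹ i) := fun i => by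
    have := hi (ψ⁻¹ i)
    rwa [show ψ (ψ⁻¹ i) = i from ψ.apply_symm_apply i] at this
  -- Two isomorphisms `τ` and `ψ` from `H` to the same opened hypergraph differ by an automorphism
  -- of `H`.
  refine ⟨⟨ψ⁻¹ * τ, ⟨σ⁻¹ * σ', fun j => ?_⟩, fun i => ?_⟩, map_helpPlaces hi', fun w => ?_⟩
  · apply Finset.map_injective ψ.toEmbedding
    rw [hσ, Finset.map_map, show σ ((σ⁻¹ * σ') j) = σ' j from σ.apply_symm_apply _, ← hσ']
    congr 1
    ext i
    simp
  · change g⁻¹ ((rule (H.openConfig num x g).trace)⁻¹ _) = _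
    rw [inv_apply_inl hi', inv_apply_inl hgi, inv_inv]
    refine congrArg Sum.inl ?_
    simp
  · have := hw w
    change visible _ _ _ ((rule (H.openConfig num x g).trace)⁻¹ _) = _ at this
    obtain ⟨w', hw'⟩ := exists_apply_inr (inv_apply_inl hi') w
    rw [hw', visible_helpPlaces_inr, ← hw'] at this
    exact Option.some_injective _ this

/-- The last rearrangement adds one more visible sequence. Since the helping cards are sorted, it is
always the initial one and reveals nothing. -/
theorem finalConfig_trace (hr : H.IsFinalRule num rule) {g : Perm H.Place} {τ : Perm (Fin n)}
    (h : IsRegular num x g τ) : (H.finalConfig num x rule g).trace =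
      visible (H.symbols num x) 1 (helpPlaces _ _) :: (H.openConfig num x g).trace := by
  obtain ⟨-, hup, hw⟩ := finalConfig_spec hr h
  change visible _ (H.finalConfig num x rule g).card (H.finalConfig num x rule g).up :: _ = _
  rw [hup]
  congr 1
  funext p
  rcases p with i | w
  · rw [visible_helpPlaces_inl, visible_helpPlaces_inl]
  · rw [visible_helpPlaces_inr, visible_helpPlaces_inr, hw]
    rfl

theorem law_invariant (hr : H.IsFinalRule num rule) {f : Perm (Fin n)} (hf : f ∈ H.aut) :
    (exec (H.protocol rule) (H.helpSymbol num) x).map (fun c => (c.outPerm * f, c.trace)) =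
      (exec (H.protocol rule) (H.helpSymbol num) x).map fun c => (c.outPerm, c.trace) := by
  obtain ⟨s, hs, u, hu, t, ht, hut, h⟩ := exists_translation hf
  rw [exec_protocol, PMF.map_comp, PMF.map_comp]
  refine map_shuffleLaw_eq hs hu ht hut fun a ha b hb d hd => ?_
  obtain ⟨ε, hεi, hεe, hε⟩ := h a ha b d
  obtain ⟨τ, hτ⟩ := exists_isRegular num x (mem_support_shuffleLaw.2 ⟨a, ha, b, hb, d, hd, rfl⟩)
  obtain ⟨τ', hτ'⟩ := exists_isRegular num x (mem_support_shuffleLaw.2 ⟨s * a, mul_mem hs ha,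
    u⁻¹ * b * u * t, mul_mem ((hut b).2 hb) ht, d * u, mul_mem hd hu, rfl⟩)
  -- From here on the modified shuffles appear only through the product `d * b * a * ε`, which opens
  -- the same symbols as `d * b * a`, so that the rule makes the same move.
  rw [hε] at hτ' ⊢
  have htr : (H.openConfig num x (d * b * a * ε)).trace = (H.openConfig num x (d * b * a)).trace :=
    congrArg (· :: _) (openedSymbols_mul hτ.1 hεe)
  obtain ⟨⟨o, -, ho⟩, -⟩ := finalConfig_spec hr hτ
  have ho' : (H.finalConfig num x rule (d * b * a * ε)).Permutes (o * f) := fun i => by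
    change (d * b * a * ε)⁻¹ ((rule (H.openConfig num x _).trace)⁻¹ _) = _
    rw [htr, mul_inv_rev, Perm.mul_apply, Perm.inv_eq_iff_eq, hεi]
    exact ho (f i)
  refine Prod.ext ?_ ?_
  · change Config.outPerm _ * f = Config.outPerm _
    rw [Config.outPerm_eq ho, Config.outPerm_eq ho']
  · change Config.trace _ = Config.trace _
    rw [finalConfig_trace hr hτ, finalConfig_trace hr hτ', htr]

theorem implements_aut (hr : H.IsFinalRule num rule) :
    Implements (H.protocol rule) (H.helpSymbol num) H.aut := by
  have hfin : ∀ (x : Fin n → S), ∀ c ∈ (exec (H.protocol rule) (H.helpSymbol num) x).support,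
      c.Permutes c.outPerm ∧ c.outPerm ∈ H.aut ∧ c.up = helpPlaces _ _ ∧
        ∀ w, H.symbols num x (c.card (.inr w)) = H.helpSymbol num w := by
    intro x c hc
    rw [exec_protocol, PMF.mem_support_map_iff] at hc
    obtain ⟨g, hg, rfl⟩ := hc
    obtain ⟨τ, hτ⟩ := exists_isRegular num x hg
    obtain ⟨⟨f, hf, hp⟩, h⟩ := finalConfig_spec hr hτ
    rw [Config.outPerm_eq hp]
    exact ⟨hp, hf, h⟩
  refine ⟨hfin, fun x => ?_, fun x => ?_⟩
  · classical
    rw [map_eq_uniformOn_of_invariant _ _ Config.trace H.aut (fun c hc => (hfin x c hc).2.1)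
      fun f hf => law_invariant hr hf]
    exact ((map_uniformOfFintype H.aut id).trans (PMF.map_id _)).symm
  · exact independent_of_invariant _ _ _ H.aut (fun c hc => (hfin x c hc).2.1)
      fun f hf => law_invariant hr hf

end FinHypergraph

/-! ### The kind and number of shuffles, the number of cards, and undirected graphs. -/

namespace CardBased

universe u

theorem isPileScramble_pileScramble {κ : Type u} {ι σ : Type*} [Finite ι] [Finite σ]
    (pile : ι × σ ↪ κ) : (Action.shuffle (pileScramble pile)).IsPileScramble := by
  obtain ⟨k, ⟨e⟩⟩ := Finite.exists_equiv_fin ι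
  obtain ⟨s, ⟨e'⟩⟩ := Finite.exists_equiv_fin σ
  refine ⟨k, s, (e.prodCongr e').symm.toEmbedding.trans pile, congrArg Action.shuffle ?_⟩
  have hr : Set.range ((e.prodCongr e').symm.toEmbedding.trans pile) = Set.range pile :=
    (e.prodCongr e').symm.surjective.range_comp pile
  ext g
  constructor
  · rintro ⟨π, hπ, hg⟩
    refine ⟨e.permCongr π, fun a r => ?_, fun p hp => hg p (hr ▸ hp)⟩
    simpa using hπ (e.symm a) (e'.symm r)
  · rintro ⟨π, hπ, hg⟩
    refine ⟨e.symm.permCongr π, fun a r => ?_, fun p hp => hg p (hr.symm ▸ hp)⟩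
    simpa using hπ (e a) (e' r)

end CardBased

namespace FinHypergraph

open CardBased

universe v

variable {n m : ℕ} {S : Type v} {H : FinHypergraph n m}

theorem isPileScramble_of_mem_shuffles {G : Subgroup (Perm H.Place)} (hG : G ∈ H.shuffles) :
    (Action.shuffle G).IsPileScramble := by
  simp only [shuffles, List.mem_append, List.mem_map] at hG
  obtain ⟨_, -, rfl⟩ | ⟨_, -, rfl⟩ | ⟨_, -, rfl⟩ := hG <;> exact isPileScramble_pileScramble _

theorem finalConfig_log {num : Fin m ↪ S} {x : Fin n → S}
    (rule : List (Visible H.Place S) → Perm H.Place) (g : Perm H.Place) :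
    ∃ π T T', (H.finalConfig num x rule g).log =
      .perm π :: .turn T :: ((H.shuffles.map .shuffle).reverse ++ [.turn T']) :=
  ⟨_, _, _, rfl⟩

variable (H) in
theorem card_place : Fintype.card H.Place = n + ∑ j, (H.edge j).card := by
  let e : H.Slot ≃ Σ j, {i // i ∈ H.edge j} :=
    { toFun := fun w => ⟨w.1.2, w.1.1, w.2⟩
      invFun := fun y => ⟨(y.2.1, y.1), y.2.2⟩
      left_inv := fun _ => rfl
      right_inv := fun _ => rfl }
  rw [Fintype.card_sum, Fintype.card_fin, Fintype.card_congr e, Fintype.card_sigma]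
  simp

/-- The directed graph of an undirected graph has the same automorphisms, on the vertices. -/
theorem aut_eq_aut₀ (h2 : ∀ j, (H.edge j).card = 2) : H.aut = H.toDirGraph.aut₀ := by
  ext f
  constructor
  · rintro ⟨σ, hσ⟩
    refine ⟨((f.prodCongr f).prodCongr σ).subtypeEquiv fun a => ?_, fun a => ⟨rfl, rfl⟩⟩
    have : (H.edge (σ a.2) = {f a.1.1, f a.1.2}) ↔ H.edge a.2 = {a.1.1, a.1.2} := by
      rw [← hσ, ← Finset.map_inj (f := f.toEmbedding) (s₁ := H.edge a.2)]
      simp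
    simp [this]
  · rintro ⟨f₁, hf⟩
    -- With parallel edges, `f₁` may send the two arcs of one edge to arcs of different edges. Hence
    -- one arc per edge is fixed, oriented from the smaller to the larger vertex, and only these
    -- arcs are followed.
    have hor : ∀ j, ∃ p : Fin n × Fin n, p.1 < p.2 ∧ H.edge j = {p.1, p.2} := by
      intro j
      obtain ⟨u, v, huv, he⟩ := Finset.card_eq_two.1 (h2 j)
      rcases lt_or_gt_of_ne huv with h | h
      · exact ⟨(u, v), h, he⟩
      · exact ⟨(v, u), h, he.trans (Finset.pair_comm _ _)⟩
    choose p hp he using hor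
    let arc : Fin m → {a : (Fin n × Fin n) × Fin m // a.1.1 ≠ a.1.2 ∧ H.edge a.2 = {a.1.1, a.1.2}} :=
      fun j => ⟨(p j, j), (hp j).ne, he j⟩
    have himg : ∀ j, (H.edge j).map f.toEmbedding = H.edge (f₁ (arc j)).1.2 := by
      intro j
      have h1 : (f₁ (arc j)).1.1.1 = f (p j).1 := (hf (arc j)).1
      have h3 : (f₁ (arc j)).1.1.2 = f (p j).2 := (hf (arc j)).2
      rw [(f₁ (arc j)).2.2, h1, h3, he]
      simp
    have hinj : Function.Injective fun j => (f₁ (arc j)).1.2 := by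
      intro j j' hjj
      have hE : H.edge j = H.edge j' := by
        apply Finset.map_injective f.toEmbedding
        rw [himg, himg]
        exact congrArg H.edge hjj
      -- Parallel edges have the same chosen orientation, so the images of their chosen arcs have
      -- the same source and target; if these also lie on the same edge, they coincide.
      have hpp : p j = p j' := by
        rw [he, he] at hE
        have h1 := hp j
        have h3 := hp j'
        have m1 : (p j).1 ∈ ({(p j').1, (p j').2} : Finset _) := hE ▸ by simp
        have m2 : (p j).2 ∈ ({(p j').1, (p j').2} : Finset _) := hE ▸ by simp
        simp only [Finset.mem_insert, Finset.mem_singleton] at m1 m2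
        refine Prod.ext ?_ ?_ <;> grind
      have hff : f₁ (arc j) = f₁ (arc j') := by
        refine Subtype.ext (Prod.ext (Prod.ext ?_ ?_) hjj)
        · exact (hf (arc j)).1.trans ((congrArg (fun q => f q.1) hpp).trans (hf (arc j')).1.symm)
        · exact (hf (arc j)).2.trans ((congrArg (fun q => f q.2) hpp).trans (hf (arc j')).2.symm)
      exact congrArg (fun a => a.1.2) (f₁.injective hff)
    exact ⟨Equiv.ofBijective _ (Finite.injective_iff_bijective.1 hinj), himg⟩

end FinHypergraph

open Classical in
theorem mainTheorem3 {n m : ℕ} (H : FinHypergraph n m) {S : Type*} (num : Fin m ↪ S) :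
    -- an admissible last step exists, whatever symbols have been opened
    (∀ x : Fin n → S, ∀ c ∈ (CardBased.exec (H.protocolOpen S) (H.helpSymbol num) x).support,
      ∃ v t, c.trace = v :: t ∧ ∃ π, H.IsFinalMove num v π) ∧
    -- however the last step is carried out, the protocol implements the hypergraph shuffle
    (∀ rule, H.IsFinalRule num rule →
      CardBased.Implements (H.protocol rule) (H.helpSymbol num) H.aut ∧
      -- with pile-scramble shuffles only, whose number is `n + d' + ℓ`
      (∀ x : Fin n → S, ∀ c ∈ (CardBased.exec (H.protocol rule) (H.helpSymbol num) x).support,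
        (∀ a ∈ c.log, a.IsShuffle → a.IsPileScramble) ∧
        c.log.countP (fun a => decide a.IsShuffle) = n + H.degrees.card + H.sizes.card)) ∧
    -- the number of cards
    Fintype.card H.Place = n + ∑ j, (H.edge j).card ∧
    -- graph shuffles of undirected graphs
    ((∀ j, (H.edge j).card = 2) →
      Fintype.card H.Place = n + 2 * m ∧
      ∀ rule, H.IsFinalRule num rule →
        CardBased.Implements (H.protocol rule) (H.helpSymbol num) H.toDirGraph.aut₀) := by
  refine ⟨fun x c hc => ?_, fun rule hr => ⟨H.implements_aut hr, fun x c hc => ?_⟩, H.card_place,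
    fun h2 => ⟨?_, fun rule hr => ?_⟩⟩
  · rw [FinHypergraph.exec_protocolOpen, PMF.mem_support_map_iff] at hc
    obtain ⟨g, hg, rfl⟩ := hc
    obtain ⟨τ, hτ⟩ := FinHypergraph.exists_isRegular num x hg
    exact ⟨_, _, rfl, _, hτ.isFinalMove⟩
  · rw [FinHypergraph.exec_protocol, PMF.mem_support_map_iff] at hc
    obtain ⟨g, hg, rfl⟩ := hc
    obtain ⟨π, T, T', h⟩ := FinHypergraph.finalConfig_log (num := num) (x := x) rule g
    rw [h]
    constructor
    · intro a ha hs
      simp only [List.mem_cons, List.mem_append, List.mem_reverse, List.mem_map,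
        List.not_mem_nil, or_false] at ha
      obtain rfl | rfl | ⟨G, hG, rfl⟩ | rfl := ha
      · exact hs.elim
      · exact hs.elim
      · exact FinHypergraph.isPileScramble_of_mem_shuffles hG
      · exact hs.elim
    · rw [← H.length_shuffles]
      have hsh : (H.shuffles.map CardBased.Action.shuffle).countP (fun a => decide a.IsShuffle) =
          H.shuffles.length := by
        rw [List.countP_eq_length.2, List.length_map]
        intro a ha
        obtain ⟨G, -, rfl⟩ := List.mem_map.1 ha
        exact decide_eq_true trivial
      have hperm : ¬ (CardBased.Action.perm π).IsShuffle := id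
      have hturn : ∀ T : Finset H.Place, ¬ (CardBased.Action.turn T).IsShuffle := fun _ => id
      rw [List.countP_cons_of_neg (by simpa only [decide_eq_true_eq] using hperm),
        List.countP_cons_of_neg (by simpa only [decide_eq_true_eq] using hturn T),
        List.countP_append, List.countP_reverse, hsh,
        List.countP_cons_of_neg (by simpa only [decide_eq_true_eq] using hturn T'),
        List.countP_nil, add_zero]
  · rw [H.card_place]
    simp [h2, mul_comm]
  · rw [← FinHypergraph.aut_eq_aut₀ h2]
    exact FinHypergraph.implements_aut hr
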